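/- Let $\Gamma=(V,\{\gamma_{ab}\})$ be a finite weighted graph: $V$ is a finite set and $\gamma_{ab}=\gamma_{ba}\in\mathbb R$. Its edges are the unordered pairs $\{a,b\}$ of distinct vertices with $\gamma_{ab}\neq 0$; an edge is black if $\gamma_{ab}>0$ and red if $\gamma_{ab}<0$. Suppose that $\Gamma$ has exactly two red edges, $x=\{i,j\}$ and $y=\{k,l\}$. For $I\subseteq\{x,y\}$ let $$A_I=\sum_{T}\ \prod_{\substack{\{a,b\}\in E(T)\\ \gamma_{ab}>0}}\gamma_{ab},$$ where $T$ runs over the spanning trees of $\Gamma$ that contain every red edge in $I$ and no other red edge. Write $A_{00}=A_\emptyset$, $A_{10}=A_{\{x\}}$, $A_{01}=A_{\{y\}}$, $A_{11}=A_{\{x,y\}}$; these are, up to sign, the coefficients of the crossing polynomial $\sum_T\prod_{e\in E(T)}\gamma_e=A_{11}t_xt_y-A_{10}t_x-A_{01}t_y+A_{00}$ of $\Gamma$ in the variables $t_x=-\gamma_{ij}$ and $t_y=-\gamma_{kl}$. Let $$\Delta=A_{11}A_{00}-A_{01}A_{10}$$ be its discriminant. An automorphism of $\Gamma$ is a permutation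 $\varphi$ of $V$ with $\gamma_{\varphi(a)\varphi(b)}=\gamma_{ab}$ for all $a,b\in V$. Assume that the edges $x$ and $y$ have no vertex in common. If there is an automorphism $\varphi$ of $\Gamma$ that exchanges $i$ and $j$ and fixes $k$ and $l$, or one that exchanges $k$ and $l$ and fixes $i$ and $j$, then $\Delta=0$. -/

import Mathlib

/-- A weighted (undirected) graph on the vertex set `V`: a real symmetric array of weights. -/
structure WeightedGraph (V : Type*) where
  /-- the weight `γ a b` of the pair `a, b` -/
  γ : V → V → ℝ
  symm : ∀ a b, γ a b = γ b a

namespace WeightedGraph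

variable {V : Type*} (Γ : WeightedGraph V)

/-- The underlying graph: two distinct vertices are joined by an edge iff their weight is nonzero.
Diagonal weights play no role, just as they do not enter the graph Laplacian. -/
def graph : SimpleGraph V where
  Adj a b := a ≠ b ∧ Γ.γ a b ≠ 0
  symm := ⟨fun a b h => ⟨h.1.symm, by rw [Γ.symm b a]; exact h.2⟩⟩
  loopless := ⟨fun _ h => h.1 rfl⟩

/-- The weight of an unordered pair of vertices. -/
def weight (e : Sym2 V) : ℝ := Sym2.lift ⟨Γ.γ, Γ.symm⟩ e

/-- An automorphism of a weighted graph: a permutation of the vertices that preserves all the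
weights. -/
def IsAutomorphism (φ : Equiv.Perm V) : Prop := ∀ a b, Γ.γ (φ a) (φ b) = Γ.γ a b

section Finite

variable [Fintype V] [DecidableEq V]

open Classical in
/-- The red edges: the edges with negative weight. -/
noncomputable def redEdges : Finset (Sym2 V) :=
  {e | e ∈ Γ.graph.edgeSet ∧ Γ.weight e < 0}

open Classical in
/-- The spanning trees of `Γ`, each given by its set of edges. -/
noncomputable def spanningTrees : Finset (Finset (Sym2 V)) :=
  {T | (T : Set (Sym2 V)) ⊆ Γ.graph.edgeSet ∧
    (SimpleGraph.fromEdgeSet (T : Set (Sym2 V))).IsTree}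

open Classical in
/-- The product of the weights of all the black (positive) edges in `T`. -/
noncomputable def blackWeight (T : Finset (Sym2 V)) : ℝ :=
  ∏ e ∈ T with 0 < Γ.weight e, Γ.weight e

open Classical in
/-- The sum of `blackWeight T` over all spanning trees `T` that contain all the edges in `I` and
none of the edges in `J`. -/
noncomputable def treeSum (I J : Finset (Sym2 V)) : ℝ :=
  ∑ T ∈ Γ.spanningTrees with I ⊆ T ∧ Disjoint J T, Γ.blackWeight T

/-- For a set `I` of red edges, the coefficient `A_I`: the sum of `blackWeight T` over all spanning
trees `T` that contain all the red edges in `I` and none of the other red edges. With red edges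
of weight `-t_e`, the crossing polynomial is the sum of
`(-1) ^ |I| * A_I * ∏ e ∈ I, t_e` over all sets `I` of red edges. -/
noncomputable def coeff (I : Finset (Sym2 V)) : ℝ := Γ.treeSum I (Γ.redEdges \ I)

/-- The discriminant `A₁₁ A₀₀ - A₀₁ A₁₀` of the crossing polynomial
`A₁₁ t_x t_y - A₁₀ t_x - A₀₁ t_y + A₀₀` of a weighted graph whose red edges are `x` and `y`. -/
noncomputable def discriminant (x y : Sym2 V) : ℝ :=
  Γ.coeff {x, y} * Γ.coeff ∅ - Γ.coeff {y} * Γ.coeff {x}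

end Finite

end WeightedGraph

/-! Let `L` be the Laplacian of the black edges, grounded at a vertex fixed by the automorphism, and
let `u`, `v` be the incidence vectors of the two red edges. By the matrix tree theorem
(`det_grounded_laplacian`), `det (L + s u uᵀ + t v vᵀ)` is the polynomial `A₀₀ + s A₁₀ + t A₀₁ + s t
A₁₁`. Its values at `s, t ∈ {0, 1}` recover Δ as `D₁₁ D₀₀ - D₁₀ D₀₁`. The automorphism preserves
`L`, negates `u` and fixes `v`, so `u` and `v` are orthogonal for the form `L⁻¹`. The determinant
then factors in `s` and `t`, and Δ vanishes (`Matrix.det_mul_det_eq_of_invariant`). -/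

section

/-! ### Determinants of sums of rank-one matrices -/

open Matrix

/-- A form of Cauchy–Binet. Expand multilinearly in the rows: a non-injective choice of summands
gives two proportional rows, and the injective choices are grouped by their image. -/
theorem Matrix.det_sum_vecMulVec {n ι R : Type*} [Fintype n] [DecidableEq n] [DecidableEq ι]
    [CommRing R] (E : Finset ι) (a b : ι → n → R) :
    (∑ e ∈ E, vecMulVec (a e) (b e)).det =
      ∑ T ∈ E.powerset with T.card = Fintype.card n, (∑ e ∈ T, vecMulVec (a e) (b e)).det := by
  have expand : ∀ S : Finset ι, (∑ e ∈ S, vecMulVec (a e) (b e)).det =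
      ∑ f ∈ Fintype.piFinset (fun _ : n => S) with Function.Injective f,
        (Matrix.of fun p => a (f p) p • b (f p)).det := by
    intro S
    have h1 : (∑ e ∈ S, vecMulVec (a e) (b e)) = fun p => ∑ e ∈ S, a e p • b e := by
      ext p q
      simp [Matrix.sum_apply, vecMulVec_apply]
    rw [h1, Finset.sum_filter_of_ne]
    · exact (detRowAlternating (n := n) (R := R)).toMultilinearMap.map_sum_finset
        (fun p e => a e p • b e) (fun _ => S)
    · intro f _ hf p q hpq
      by_contra hne
      apply hf
      have h2 : (Matrix.of fun p => a (f p) p • b (f p)).det =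
          (∏ p, a (f p) p) * (Matrix.of fun p => b (f p)).det := by
        rw [← Matrix.det_mul_column]; rfl
      rw [h2, Matrix.det_zero_of_row_eq hne (congrArg b hpq), mul_zero]
  rw [expand E]
  simp only [expand]
  rw [← Finset.sum_fiberwise_of_maps_to (s := Finset.filter _ _)
    (t := E.powerset.filter fun T => T.card = Fintype.card n)
    (g := fun f => Finset.univ.image f)]
  · refine Finset.sum_congr rfl fun T hT => Finset.sum_congr ?_ fun _ _ => rfl
    rw [Finset.mem_filter, Finset.mem_powerset] at hT
    ext f
    simp only [Finset.mem_filter, Fintype.mem_piFinset]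
    constructor
    · rintro ⟨⟨_, h2⟩, rfl⟩
      exact ⟨fun p => Finset.mem_image_of_mem f (Finset.mem_univ p), h2⟩
    · rintro ⟨h1, h2⟩
      refine ⟨⟨fun p => hT.1 (h1 p), h2⟩, Finset.eq_of_subset_of_card_le ?_ ?_⟩
      · rw [Finset.image_subset_iff]; exact fun p _ => h1 p
      · rw [Finset.card_image_of_injective _ h2, Finset.card_univ, hT.2]
  · intro f hf
    simp only [Finset.mem_filter, Fintype.mem_piFinset] at hf
    simp only [Finset.mem_filter, Finset.mem_powerset, Finset.image_subset_iff]
    exact ⟨fun p _ => hf.1 p, by rw [Finset.card_image_of_injective _ hf.2, Finset.card_univ]⟩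

/-- The sum is `Bᵀ D B` with `B` an integer matrix; spanning makes `B` invertible over ℤ, so its
determinant squares to 1. -/
theorem Matrix.det_sum_smul_vecMulVec_of_span_eq_top {n ι : Type*} [Fintype n] [DecidableEq n]
    (T : Finset ι) (hT : T.card = Fintype.card n) (w : ι → ℝ) (b : ι → n → ℤ)
    (hb : Submodule.span ℤ (b '' T) = ⊤) :
    (∑ e ∈ T, vecMulVec (w e • fun p => (b e p : ℝ)) (fun p => (b e p : ℝ))).det =
      ∏ e ∈ T, w e := by
  obtain ⟨σ⟩ : Nonempty (n ≃ T) := Fintype.card_eq.mp (by simp [hT])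
  let B : Matrix n n ℤ := Matrix.of fun p => b (σ p)
  have hB : IsUnit B := by
    rw [← Matrix.vecMul_surjective_iff_isUnit]
    have h1 : LinearMap.range B.vecMulLinear = ⊤ := by
      rw [range_vecMulLinear, ← hb]
      congr 1
      ext z
      constructor
      · rintro ⟨p, rfl⟩
        exact ⟨σ p, (σ p).2, rfl⟩
      · rintro ⟨e, he, rfl⟩
        exact ⟨σ.symm ⟨e, he⟩, congrArg (fun x : T => b x) (σ.apply_symm_apply ⟨e, he⟩)⟩
    exact LinearMap.range_eq_top.mp h1
  have hsq : (B.map (Int.cast : ℤ → ℝ)).det * (B.map (Int.cast : ℤ → ℝ)).det = 1 := by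
    rw [← Int.cast_det, ← Int.cast_mul, Int.isUnit_mul_self ((Matrix.isUnit_iff_isUnit_det B).mp hB),
      Int.cast_one]
  have hM : (∑ e ∈ T, vecMulVec (w e • fun p => (b e p : ℝ)) (fun p => (b e p : ℝ))) =
      (B.map (Int.cast : ℤ → ℝ))ᵀ * diagonal (fun p => w (σ p)) * B.map (Int.cast : ℤ → ℝ) := by
    ext p q
    rw [Matrix.sum_apply, Matrix.mul_apply, ← Finset.sum_coe_sort, ← σ.sum_comp]
    refine Finset.sum_congr rfl fun m _ => ?_
    simp [B, vecMulVec_apply, Matrix.mul_diagonal, mul_comm]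
  rw [hM, det_mul, det_mul, det_transpose, det_diagonal, mul_right_comm, hsq, one_mul,
    ← Finset.prod_coe_sort T, ← σ.prod_comp]

/-! ### The matrix tree theorem -/

/-- The column of the oriented incidence matrix at the edge `e`. The diagonal pair `s(r, r)`
stands for the root `r`. -/
noncomputable def rootedIncidence {V : Type*} [DecidableEq V] (r : V) (e : Sym2 V) : V → ℤ :=
  if e = s(r, r) then Pi.single r 1 else Pi.single e.out.1 1 - Pi.single e.out.2 1

section MatrixTree

variable {V : Type*} [DecidableEq V]

theorem rootedIncidence_root (r : V) : rootedIncidence r s(r, r) = Pi.single r 1 := if_pos rfl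

theorem rootedIncidence_mk (r : V) {a b : V} (h : a ≠ b) :
    rootedIncidence r s(a, b) = Pi.single a 1 - Pi.single b 1 ∨
      rootedIncidence r s(a, b) = -(Pi.single a 1 - Pi.single b 1) := by
  have hne : s(a, b) ≠ s(r, r) := by
    intro h1
    rw [Sym2.eq_iff] at h1
    rcases h1 with ⟨rfl, rfl⟩ | ⟨rfl, rfl⟩ <;> exact h rfl
  rw [rootedIncidence, if_neg hne]
  have hout : s((s(a, b) : Sym2 V).out.1, (s(a, b) : Sym2 V).out.2) = s(a, b) := by
    rw [Sym2.mk, Quot.out_eq]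
  rcases Sym2.eq_iff.mp hout with ⟨h1, h2⟩ | ⟨h1, h2⟩
  · left; rw [h1, h2]
  · right; rw [h1, h2, neg_sub]

variable [Fintype V]

/-- The root supplies one basis vector, and each edge of a walk from the root carries membership in
the span to the next vertex. -/
theorem span_rootedIncidence_eq_top (r : V) (T : Finset (Sym2 V))
    (hT : (SimpleGraph.fromEdgeSet (T : Set (Sym2 V))).Connected) :
    Submodule.span ℤ (rootedIncidence r '' ↑(insert s(r, r) T)) = ⊤ := by
  set S := Submodule.span ℤ (rootedIncidence r '' ↑(insert s(r, r) T))
  have hroot : (Pi.single r 1 : V → ℤ) ∈ S := by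
    rw [← rootedIncidence_root]
    exact Submodule.subset_span ⟨_, by simp, rfl⟩
  have hstep : ∀ a b, (SimpleGraph.fromEdgeSet (T : Set (Sym2 V))).Adj a b →
      (Pi.single a 1 : V → ℤ) ∈ S → (Pi.single b 1 : V → ℤ) ∈ S := by
    intro a b hab ha
    rw [SimpleGraph.fromEdgeSet_adj] at hab
    have he : rootedIncidence r s(a, b) ∈ S :=
      Submodule.subset_span ⟨_, by simpa using Or.inr hab.1, rfl⟩
    have hd : (Pi.single a 1 - Pi.single b 1 : V → ℤ) ∈ S := by
      rcases rootedIncidence_mk r hab.2 with h | h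
      · rwa [h] at he
      · rwa [h, neg_mem_iff] at he
    simpa using sub_mem ha hd
  have hall : ∀ v, (Pi.single v 1 : V → ℤ) ∈ S := by
    intro v
    obtain ⟨p⟩ := hT.preconnected r v
    clear_value S
    induction p with
    | nil => exact hroot
    | cons hadj _ ih => exact ih (hstep _ _ hadj hroot)
  rw [eq_top_iff]
  intro z _
  rw [pi_eq_sum_univ' z]
  exact Submodule.sum_mem _ fun v _ => Submodule.smul_mem _ _ (by
    convert hall v using 1)

theorem det_sum_rootedIncidence_eq_zero (r : V) (T : Finset (Sym2 V)) (w : Sym2 V → ℝ)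
    (z : V → ℝ) (hz : z ≠ 0)
    (hT : ∀ e ∈ T, ∑ v, (rootedIncidence r e v : ℝ) * z v = 0) :
    (∑ e ∈ T, vecMulVec (w e • fun v => (rootedIncidence r e v : ℝ))
      (fun v => (rootedIncidence r e v : ℝ))).det = 0 := by
  rw [← Matrix.exists_mulVec_eq_zero_iff]
  refine ⟨z, hz, ?_⟩
  rw [Matrix.sum_mulVec]
  refine Finset.sum_eq_zero fun e he => ?_
  ext p
  rw [Matrix.vecMulVec_mulVec]
  simp [dotProduct, hT e he]

theorem sum_rootedIncidence_mul (r : V) {a b : V} (h : a ≠ b) {z : V → ℝ} (hz : z a = z b) :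
    ∑ v, (rootedIncidence r s(a, b) v : ℝ) * z v = 0 := by
  have h1 : ∑ v, ((Pi.single a 1 - Pi.single b 1 : V → ℤ) v : ℝ) * z v = 0 := by
    simp [sub_mul, Pi.single_apply, hz]
  rcases rootedIncidence_mk r h with h2 | h2
  · rw [h2, h1]
  · rw [h2]
    simp only [Pi.neg_apply, Int.cast_neg, neg_mul, Finset.sum_neg_distrib, h1, neg_zero]

open Classical in
/-- The weighted **matrix tree theorem**, for the Laplacian grounded at the root `r`. -/
theorem det_grounded_laplacian (r : V) (E : Finset (Sym2 V)) (hE : ∀ e ∈ E, ¬ e.IsDiag)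
    (w : Sym2 V → ℝ) :
    (vecMulVec (Pi.single r 1) (Pi.single r 1) +
      ∑ e ∈ E, w e • vecMulVec (fun v => (rootedIncidence r e v : ℝ))
        (fun v => (rootedIncidence r e v : ℝ))).det =
    ∑ T ∈ E.powerset.filter fun T : Finset (Sym2 V) => (SimpleGraph.fromEdgeSet (T : Set (Sym2 V))).IsTree, ∏ e ∈ T, w e := by
  have hrE : s(r, r) ∉ E := fun h => hE _ h rfl
  -- Grounding is treated as an extra edge of weight 1, the loop at `r`.
  let w' : Sym2 V → ℝ := Function.update w s(r, r) 1
  have hw' : ∀ e ∈ E, w' e = w e := fun e he =>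
    Function.update_of_ne (fun h : e = s(r, r) => hrE (h ▸ he)) _ _
  have hM : vecMulVec (Pi.single r 1) (Pi.single r 1) +
      ∑ e ∈ E, w e • vecMulVec (fun v => (rootedIncidence r e v : ℝ))
        (fun v => (rootedIncidence r e v : ℝ)) =
      ∑ e ∈ insert s(r, r) E, vecMulVec (w' e • fun v => (rootedIncidence r e v : ℝ))
        (fun v => (rootedIncidence r e v : ℝ)) := by
    rw [Finset.sum_insert hrE]
    congr 1
    · simp only [w', Function.update_self, one_smul, rootedIncidence_root]
      congr 1 <;> ext v <;> simp [Pi.single_apply]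
    · exact Finset.sum_congr rfl fun e he => by rw [hw' e he, smul_vecMulVec]
  rw [hM, Matrix.det_sum_vecMulVec, Finset.sum_filter, Finset.sum_powerset_insert hrE,
    Finset.sum_filter]
  refine (add_eq_right.mpr (Finset.sum_eq_zero ?_)).trans ?_
  rotate_left
  · refine Finset.sum_congr rfl fun T hT => ?_
    rw [Finset.mem_powerset] at hT
    have hrT : s(r, r) ∉ T := fun h => hrE (hT h)
    have hedge : (SimpleGraph.fromEdgeSet (T : Set (Sym2 V))).edgeSet = T := by
      rw [SimpleGraph.edgeSet_fromEdgeSet]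
      ext e
      simp only [Set.mem_sdiff, Finset.mem_coe]
      exact ⟨And.left, fun h => ⟨h, hE e (hT h)⟩⟩
    have htree : (SimpleGraph.fromEdgeSet (T : Set (Sym2 V))).IsTree ↔
        (SimpleGraph.fromEdgeSet (T : Set (Sym2 V))).Connected ∧
          (insert s(r, r) T).card = Fintype.card V := by
      rw [SimpleGraph.isTree_iff_connected_and_card, hedge, Finset.card_insert_of_notMem hrT]
      simp
    by_cases hcard : (insert s(r, r) T).card = Fintype.card V
    swap
    · rw [if_neg hcard, if_neg fun h => hcard (htree.mp h).2]
    rw [if_pos hcard]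
    by_cases hconn : (SimpleGraph.fromEdgeSet (T : Set (Sym2 V))).Connected
    · rw [if_pos (htree.mpr ⟨hconn, hcard⟩), Matrix.det_sum_smul_vecMulVec_of_span_eq_top _ hcard _ _
        (span_rootedIncidence_eq_top r T hconn), Finset.prod_insert hrT]
      simp only [w', Function.update_self, one_mul]
      exact Finset.prod_congr rfl fun e he => hw' e (hT he)
    · rw [if_neg fun h => hconn (htree.mp h).1]
      set H := SimpleGraph.fromEdgeSet (T : Set (Sym2 V)) with hH
      obtain ⟨v, hv⟩ : ∃ v, ¬ H.Reachable r v := by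
        by_contra! hall
        have : Nonempty V := ⟨r⟩
        exact hconn ⟨fun a b => (hall a).symm.trans (hall b)⟩
      -- The indicator of the vertices not reachable from `r` lies in the kernel.
      refine det_sum_rootedIncidence_eq_zero r _ _ (fun u => if H.Reachable r u then 0 else 1)
        (fun h0 => by simpa [hv] using congrFun h0 v) fun e he => ?_
      rcases Finset.mem_insert.mp he with rfl | he
      · rw [rootedIncidence_root]
        refine Finset.sum_eq_zero fun u _ => ?_
        by_cases hu : u = r <;> simp [hu]
      · induction e using Sym2.ind with
        | _ a b =>
          have hab : a ≠ b := fun h => hE _ (hT he) h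
          have hadj : H.Adj a b := by
            rw [hH, SimpleGraph.fromEdgeSet_adj]
            exact ⟨he, hab⟩
          refine sum_rootedIncidence_mul r hab (if_congr ?_ rfl rfl)
          exact ⟨fun h => h.trans hadj.reachable, fun h => h.trans hadj.symm.reachable⟩
  -- Without the loop, constant vectors lie in the kernel.
  · intro T hT
    rw [Finset.mem_powerset] at hT
    split_ifs
    · refine det_sum_rootedIncidence_eq_zero r _ _ 1
        (fun h => one_ne_zero (congrFun h r)) fun e he => ?_
      induction e using Sym2.ind with
      | _ a b => exact sum_rootedIncidence_mul r (fun h => hE _ (hT he) h) rfl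
    · rfl

end MatrixTree

/-! ### Rank-two updates of a matrix with a symmetry -/

theorem Matrix.det_mul_det_eq_of_invariant {n : Type*} [Fintype n] [DecidableEq n]
    (M : Matrix n n ℝ) (φ : Equiv.Perm n) (u v : n → ℝ) (hM : M.submatrix φ φ = M)
    (hu : ∀ p, u (φ p) = -u p) (hv : ∀ p, v (φ p) = v p) :
    (M + vecMulVec u u + vecMulVec v v).det * M.det =
      (M + vecMulVec u u).det * (M + vecMulVec v v).det := by
  -- For invertible `M`, the determinant lemma reduces to a 2×2 matrix, whose off-diagonal entries
  -- equal their own negatives by the symmetry.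
  have key : ∀ M : Matrix n n ℝ, M.submatrix φ φ = M → IsUnit M.det →
      (M + vecMulVec u u + vecMulVec v v).det * M.det =
      (M + vecMulVec u u).det * (M + vecMulVec v v).det := by
    intro M hM hdet
    have hG : M⁻¹.submatrix φ φ = M⁻¹ := by
      rw [← Matrix.inv_submatrix_equiv, hM]
    have huv : u ⬝ᵥ (M⁻¹ *ᵥ v) = 0 := by
      have h : u ⬝ᵥ (M⁻¹ *ᵥ v) = -(u ⬝ᵥ (M⁻¹ *ᵥ v)) := by
        simp only [dotProduct, mulVec]
        rw [← Finset.sum_neg_distrib]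
        rw [← Equiv.sum_comp φ]
        refine Finset.sum_congr rfl fun p _ => ?_
        rw [← Equiv.sum_comp φ, hu, neg_mul]
        simp only [hv]
        simp only [← congrFun₂ hG p, submatrix_apply]
      linarith
    have hvu : v ⬝ᵥ (M⁻¹ *ᵥ u) = 0 := by
      have h : v ⬝ᵥ (M⁻¹ *ᵥ u) = -(v ⬝ᵥ (M⁻¹ *ᵥ u)) := by
        simp only [dotProduct, mulVec]
        rw [← Finset.sum_neg_distrib]
        rw [← Equiv.sum_comp φ]
        refine Finset.sum_congr rfl fun p _ => ?_
        rw [← Equiv.sum_comp φ, hv, ← mul_neg, ← Finset.sum_neg_distrib]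
        simp only [hu]
        simp only [← congrFun₂ hG p, submatrix_apply, mul_neg]
      linarith
    have hst : ∀ s t : ℝ, (M + s • vecMulVec u u + t • vecMulVec v v).det =
        M.det * ((1 + s * (u ⬝ᵥ (M⁻¹ *ᵥ u))) * (1 + t * (v ⬝ᵥ (M⁻¹ *ᵥ v)))) := by
      intro s t
      have h1 : M + s • vecMulVec u u + t • vecMulVec v v =
          M + (Matrix.of ![s • u, t • v])ᵀ * Matrix.of ![u, v] := by
        ext p q
        simp [Matrix.mul_apply, vecMulVec_apply]
        ring
      have h2 : (1 + Matrix.of ![u, v] * M⁻¹ * (Matrix.of ![s • u, t • v])ᵀ) =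
          !![1 + s * (u ⬝ᵥ (M⁻¹ *ᵥ u)), 0; 0, 1 + t * (v ⬝ᵥ (M⁻¹ *ᵥ v))] := by
        have h3 : ∀ a b, (Matrix.of ![u, v] * M⁻¹ * (Matrix.of ![s • u, t • v])ᵀ) a b =
            (![u, v] a) ⬝ᵥ (M⁻¹ *ᵥ (![s • u, t • v] b)) := by
          intro a b
          rw [Matrix.mul_assoc]
          rfl
        ext a b
        rw [Matrix.add_apply, h3]
        fin_cases a <;> fin_cases b <;> simp [mulVec_smul, huv, hvu]
      rw [h1, det_add_mul _ _ hdet, h2, det_fin_two_of]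
      ring
    have h11 := hst 1 1
    have h10 := hst 1 0
    have h01 := hst 0 1
    simp only [one_smul, zero_smul, add_zero, one_mul, zero_mul] at h11 h10 h01
    rw [h11, h10, h01]
    ring
  -- Singular `M`: the shift `M + ε • 1` keeps the symmetry and is invertible for all but finitely
  -- many `ε`, so continuity gives `ε = 0`.
  have hfin : {ε : ℝ | (M + ε • (1 : Matrix n n ℝ)).det = 0}.Finite := by
    refine ((-M).charpoly.roots.toFinset.finite_toSet).subset fun ε hε => ?_
    simp only [Finset.mem_coe, Multiset.mem_toFinset,
      Polynomial.mem_roots (Matrix.charpoly_monic _).ne_zero, Polynomial.IsRoot.def]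
    rw [Matrix.eval_charpoly]
    have hε' : (M + ε • (1 : Matrix n n ℝ)).det = 0 := hε
    rw [← hε', sub_neg_eq_add, add_comm]
    simp [Matrix.smul_one_eq_diagonal, Matrix.scalar_apply]
  have hc : ∀ A : Matrix n n ℝ, Continuous fun ε : ℝ => (M + ε • (1 : Matrix n n ℝ) + A).det := by
    intro A
    fun_prop
  have hext : (fun ε : ℝ => (M + ε • (1 : Matrix n n ℝ) + (vecMulVec u u + vecMulVec v v)).det *
      (M + ε • (1 : Matrix n n ℝ) + 0).det) = fun ε : ℝ =>
      (M + ε • (1 : Matrix n n ℝ) + vecMulVec u u).det *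
      (M + ε • (1 : Matrix n n ℝ) + vecMulVec v v).det := Continuous.ext_on (hfin.countable.dense_compl ℝ)
    ((hc (vecMulVec u u + vecMulVec v v)).mul (hc 0))
    ((hc (vecMulVec u u)).mul (hc (vecMulVec v v))) (fun ε hε => by
      have := key (M + ε • (1 : Matrix n n ℝ)) (by
        rw [Matrix.submatrix_add, Pi.add_apply, Pi.add_apply, hM, Matrix.submatrix_smul]
        simp) (isUnit_iff_ne_zero.mpr hε)
      simpa only [add_zero, add_assoc] using this)
  have := congrFun hext 0
  simpa only [add_zero, zero_smul, add_assoc] using this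

/-! ### The black Laplacian and the coefficients of the crossing polynomial -/

namespace WeightedGraph

variable {V : Type*} (Γ : WeightedGraph V)

theorem weight_ne_zero_of_mem_edgeSet {e : Sym2 V} (he : e ∈ Γ.graph.edgeSet) :
    Γ.weight e ≠ 0 := by
  induction e using Sym2.ind with
  | _ a b => exact he.2

theorem weight_map {φ : Equiv.Perm V} (hφ : Γ.IsAutomorphism φ) (e : Sym2 V) :
    Γ.weight (e.map φ) = Γ.weight e := by
  induction e using Sym2.ind with
  | _ a b => exact hφ a b

theorem map_mem_edgeSet {φ : Equiv.Perm V} (hφ : Γ.IsAutomorphism φ) (e : Sym2 V) :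
    e.map φ ∈ Γ.graph.edgeSet ↔ e ∈ Γ.graph.edgeSet := by
  induction e using Sym2.ind with
  | _ a b =>
    change (φ a ≠ φ b ∧ Γ.γ (φ a) (φ b) ≠ 0) ↔ (a ≠ b ∧ Γ.γ a b ≠ 0)
    rw [hφ, φ.injective.ne_iff]

variable [Fintype V] [DecidableEq V]

open Classical in
/-- The black edges: the edges with positive weight. -/
noncomputable def blackEdges : Finset (Sym2 V) := {e | e ∈ Γ.graph.edgeSet ∧ 0 < Γ.weight e}

/-- The Laplacian of the black subgraph, grounded at the vertex `r`. -/
noncomputable def blackLaplacian (r : V) : Matrix V V ℝ :=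
  vecMulVec (Pi.single r 1) (Pi.single r 1) +
    ∑ e ∈ Γ.blackEdges, Γ.weight e • vecMulVec (fun v => (rootedIncidence r e v : ℝ))
      (fun v => (rootedIncidence r e v : ℝ))

theorem blackLaplacian_submatrix (r : V) {φ : Equiv.Perm V} (hφ : Γ.IsAutomorphism φ)
    (hr : φ r = r) : (Γ.blackLaplacian r).submatrix φ φ = Γ.blackLaplacian r := by
  -- The chosen orientations need not be respected by `φ`, but a sign cancels in the product of two
  -- entries.
  have hinc : ∀ e ∈ Γ.blackEdges, ∀ p q,
      (rootedIncidence r (e.map φ) (φ p) : ℝ) * rootedIncidence r (e.map φ) (φ q) =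
        rootedIncidence r e p * rootedIncidence r e q := by
    intro e he p q
    simp only [blackEdges, Finset.mem_filter] at he
    induction e using Sym2.ind with
    | _ a b =>
      have hab : a ≠ b := he.2.1.1
      rw [Sym2.map_mk]
      rcases rootedIncidence_mk r hab with h1 | h1 <;>
      rcases rootedIncidence_mk r (φ.injective.ne hab) with h2 | h2 <;>
      · simp only [h1, h2, Pi.neg_apply, Pi.sub_apply, Pi.single_apply, φ.injective.eq_iff] <;>
          push_cast <;> ring
  ext p q
  simp only [blackLaplacian, submatrix_apply, Matrix.add_apply, Matrix.sum_apply,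
    Matrix.smul_apply, vecMulVec_apply]
  congr 1
  · have h : ∀ p, (Pi.single r 1 : V → ℝ) (φ p) = (Pi.single r 1 : V → ℝ) p := by
      intro p
      simp only [Pi.single_apply]
      exact if_congr (by rw [← hr, φ.injective.eq_iff, hr]) rfl rfl
    rw [h, h]
  · symm
    refine Finset.sum_bij (fun e _ => e.map φ) ?_ ?_ ?_ ?_
    · intro e he
      simpa [blackEdges, Γ.map_mem_edgeSet hφ, Γ.weight_map hφ] using he
    · intro e _ f _ h
      exact Sym2.map.injective φ.injective h
    · intro e he
      have he' : (e.map φ.symm).map φ = e := by simp [Sym2.map_map]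
      refine ⟨e.map φ.symm, ?_, he'⟩
      rw [← he'] at he
      simpa [blackEdges, Γ.map_mem_edgeSet hφ, Γ.weight_map hφ] using he
    · intro e he
      rw [Γ.weight_map hφ, hinc e he]

variable {Γ}

/-- Giving the red edges free weights `s`, `t` sorts the trees by which red edges they contain. -/
theorem sum_spanningTrees_prod {x y : Sym2 V} (hxy : x ≠ y) (hred : Γ.redEdges = {x, y})
    (s t : ℝ) :
    ∑ T ∈ Γ.spanningTrees, ∏ e ∈ T, (if e = x then s else if e = y then t else Γ.weight e) =
      Γ.coeff ∅ + s * Γ.coeff {x} + t * Γ.coeff {y} + s * t * Γ.coeff {x, y} := by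
  classical
  have hx : Γ.weight x < 0 := by
    have h : x ∈ Γ.redEdges := by simp [hred]
    exact (Finset.mem_filter.mp h).2.2
  have hy : Γ.weight y < 0 := by
    have h : y ∈ Γ.redEdges := by simp [hred]
    exact (Finset.mem_filter.mp h).2.2
  have hprod : ∀ T ∈ Γ.spanningTrees,
      ∏ e ∈ T, (if e = x then s else if e = y then t else Γ.weight e) =
        Γ.blackWeight T * ((if x ∈ T then s else 1) * (if y ∈ T then t else 1)) := by
    intro T hT
    have hTE := (Finset.mem_filter.mp hT).2.1
    have h : ∀ e ∈ T, (if e = x then s else if e = y then t else Γ.weight e) =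
        (if 0 < Γ.weight e then Γ.weight e else 1) *
          ((if x = e then s else 1) * (if y = e then t else 1)) := by
      intro e he
      by_cases h1 : e = x
      · subst h1
        simp [hx.not_gt, hxy.symm]
      by_cases h2 : e = y
      · subst h2
        simp [hy.not_gt, hxy, h1]
      have h3 : 0 < Γ.weight e := by
        by_contra h3
        have h4 : e ∈ Γ.redEdges := Finset.mem_filter.mpr ⟨Finset.mem_univ _, hTE he,
          lt_of_le_of_ne (not_lt.mp h3) (Γ.weight_ne_zero_of_mem_edgeSet (hTE he))⟩
        simp [hred, h1, h2] at h4
      simp [h1, h2, h3, Ne.symm h1, Ne.symm h2]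
    rw [Finset.prod_congr rfl h, Finset.prod_mul_distrib, Finset.prod_mul_distrib,
      Finset.prod_ite_eq, Finset.prod_ite_eq, blackWeight, Finset.prod_filter]
  rw [Finset.sum_congr rfl hprod]
  simp only [coeff, treeSum, hred, Finset.sum_filter, Finset.mul_sum]
  rw [← Finset.sum_add_distrib, ← Finset.sum_add_distrib, ← Finset.sum_add_distrib]
  refine Finset.sum_congr rfl fun T _ => ?_
  have e1 : ({x, y} : Finset (Sym2 V)) \ {x} = {y} := by
    ext e; simp only [Finset.mem_sdiff, Finset.mem_insert, Finset.mem_singleton]; grind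
  have e2 : ({x, y} : Finset (Sym2 V)) \ {y} = {x} := by
    ext e; simp only [Finset.mem_sdiff, Finset.mem_insert, Finset.mem_singleton]; grind
  rw [e1, e2, Finset.sdiff_self, Finset.sdiff_empty]
  by_cases h1 : x ∈ T <;> by_cases h2 : y ∈ T <;>
    simp [h1, h2, Finset.insert_subset_iff] <;> ring

theorem det_blackLaplacian_add {x y : Sym2 V} (hxy : x ≠ y) (hred : Γ.redEdges = {x, y})
    (r : V) (s t : ℝ) :
    (Γ.blackLaplacian r +
      s • vecMulVec (fun v => (rootedIncidence r x v : ℝ)) (fun v => (rootedIncidence r x v : ℝ)) +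
      t • vecMulVec (fun v => (rootedIncidence r y v : ℝ))
        (fun v => (rootedIncidence r y v : ℝ))).det =
      Γ.coeff ∅ + s * Γ.coeff {x} + t * Γ.coeff {y} + s * t * Γ.coeff {x, y} := by
  classical
  have hredx : x ∈ Γ.redEdges := by simp [hred]
  have hredy : y ∈ Γ.redEdges := by simp [hred]
  simp only [redEdges, Finset.mem_filter, Finset.mem_univ, true_and] at hredx hredy
  let E : Finset (Sym2 V) := {e | e ∈ Γ.graph.edgeSet}
  have hE : E = insert y (insert x Γ.blackEdges) := by
    ext e
    simp only [E, blackEdges, Finset.mem_filter, Finset.mem_univ, true_and, Finset.mem_insert]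
    constructor
    · intro he
      by_cases h : 0 < Γ.weight e
      · exact Or.inr (Or.inr ⟨he, h⟩)
      · have h4 : e ∈ Γ.redEdges := Finset.mem_filter.mpr ⟨Finset.mem_univ _, he,
          lt_of_le_of_ne (not_lt.mp h) (Γ.weight_ne_zero_of_mem_edgeSet he)⟩
        rw [hred, Finset.mem_insert, Finset.mem_singleton] at h4
        tauto
    · rintro (rfl | rfl | h)
      · exact hredy.1
      · exact hredx.1
      · exact h.1
  have hxb : x ∉ Γ.blackEdges := by simp [blackEdges, hredx.2.le]
  have hyb : y ∉ Γ.blackEdges := by simp [blackEdges, hredy.2.le]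
  have hyb' : y ∉ insert x Γ.blackEdges := by simp [hyb, hxy.symm]
  have htrees : Γ.spanningTrees = E.powerset.filter fun T : Finset (Sym2 V) =>
      (SimpleGraph.fromEdgeSet (T : Set (Sym2 V))).IsTree := by
    ext T
    simp [spanningTrees, E, Finset.subset_iff, Set.subset_def]
  rw [← sum_spanningTrees_prod hxy hred, htrees, ← det_grounded_laplacian r E
    (fun e he => Γ.graph.not_isDiag_of_mem_edgeSet (by simpa [E] using he)), hE,
    Finset.sum_insert hyb', Finset.sum_insert hxb, blackLaplacian]
  congr 1
  have hb : ∀ e ∈ Γ.blackEdges, (if e = x then s else if e = y then t else Γ.weight e) =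
      Γ.weight e := fun e he => by
    rw [if_neg fun h : e = x => hxb (h ▸ he), if_neg fun h : e = y => hyb (h ▸ he)]
  rw [if_neg hxy.symm, if_pos rfl, if_pos rfl,
    Finset.sum_congr rfl fun e he => congrArg (· • vecMulVec
      (fun v => (rootedIncidence r e v : ℝ)) (fun v => (rootedIncidence r e v : ℝ))) (hb e he)]
  abel

theorem discriminant_eq_zero_of_swap_left {i j k l : V}
    (hred : Γ.redEdges = {s(i, j), s(k, l)}) (hxy : s(i, j) ≠ s(k, l))
    {φ : Equiv.Perm V} (hφ : Γ.IsAutomorphism φ)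
    (hi : φ i = j) (hj : φ j = i) (hk : φ k = k) (hl : φ l = l) :
    Γ.discriminant s(i, j) s(k, l) = 0 := by
  classical
  have hij : i ≠ j := by
    have h : s(i, j) ∈ Γ.redEdges := by simp [hred]
    exact (Finset.mem_filter.mp h).2.1.1
  have hkl : k ≠ l := by
    have h : s(k, l) ∈ Γ.redEdges := by simp [hred]
    exact (Finset.mem_filter.mp h).2.1.1
  have hap : ∀ {a b : V} (_ : φ a = b) (p : V),
      (Pi.single b 1 : V → ℤ) (φ p) = (Pi.single a 1 : V → ℤ) p := by
    rintro a b rfl p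
    simp [Pi.single_apply]
  have hu : ∀ p, (rootedIncidence k s(i, j) (φ p) : ℝ) = -rootedIncidence k s(i, j) p := by
    intro p
    rcases rootedIncidence_mk k hij with h | h <;> rw [h] <;>
    simp only [Pi.sub_apply, Pi.neg_apply, hap hi, hap hj] <;> push_cast <;> ring
  have hv : ∀ p, (rootedIncidence k s(k, l) (φ p) : ℝ) = rootedIncidence k s(k, l) p := by
    intro p
    rcases rootedIncidence_mk k hkl with h | h <;> rw [h] <;>
    simp only [Pi.sub_apply, Pi.neg_apply, hap hk, hap hl]
  -- The root is `k` because `φ` must fix it.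
  have key := Matrix.det_mul_det_eq_of_invariant (Γ.blackLaplacian k) φ
    (fun p => (rootedIncidence k s(i, j) p : ℝ)) (fun p => (rootedIncidence k s(k, l) p : ℝ))
    (Γ.blackLaplacian_submatrix k hφ hk) hu hv
  have hdet := det_blackLaplacian_add hxy hred k
  have h00 := hdet 0 0
  have h10 := hdet 1 0
  have h01 := hdet 0 1
  have h11 := hdet 1 1
  simp only [one_smul, zero_smul, add_zero] at h00 h10 h01 h11
  rw [h00, h10, h01, h11] at key
  rw [discriminant]
  linear_combination key

end WeightedGraph

end

theorem mainTheorem7 {V : Type*} [Fintype V] [DecidableEq V] (Γ : WeightedGraph V) (i j k l : V)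
    (hred : Γ.redEdges = {s(i, j), s(k, l)})
    (hdisj : i ≠ k ∧ i ≠ l ∧ j ≠ k ∧ j ≠ l)
    (φ : Equiv.Perm V) (hφ : Γ.IsAutomorphism φ)
    (hswap : (φ i = j ∧ φ j = i ∧ φ k = k ∧ φ l = l) ∨
      (φ k = l ∧ φ l = k ∧ φ i = i ∧ φ j = j)) :
    Γ.discriminant s(i, j) s(k, l) = 0 := by
  have hxy : s(i, j) ≠ s(k, l) := by
    rw [Ne, Sym2.eq_iff]
    tauto
  rcases hswap with ⟨hi, hj, hk, hl⟩ | ⟨hk, hl, hi, hj⟩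
  · exact WeightedGraph.discriminant_eq_zero_of_swap_left hred hxy hφ hi hj hk hl
  -- The discriminant is symmetric in the two red edges.
  · have h := WeightedGraph.discriminant_eq_zero_of_swap_left
      (hred.trans (Finset.pair_comm _ _)) hxy.symm hφ hk hl hi hj
    rw [WeightedGraph.discriminant, Finset.pair_comm] at h
    rw [WeightedGraph.discriminant]
    linear_combination h
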